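/- Let $\Theta$ be a set and let $\{S_\theta:\theta\in\Theta\}$ be an arbitrary family of (measurable, real-valued) scoring functions $S_\theta(x,y)$ of a forecast $x$ and an observation $y$. For a sequence of triplets $(x_{k1},x_{k2},y_k)$, $k\ge 1$ (two forecasts each of the observation $y_k$; "the data"), put $$d_k(\theta)=S_\theta(x_{k1},y_k)-S_\theta(x_{k2},y_k),\qquad \gamma_n(\theta_1,\theta_2)=n^{-1}\sum_{k\le n}d_k(\theta_1)\,d_k(\theta_2).$$ Let $\sigma_1,\sigma_2,\ldots$ be i.i.d. random signs with $\Pr[\sigma_k=1]=\Pr[\sigma_k=-1]=1/2$, and put $$D_n^*(\theta)=n^{-1/2}\sum_{k\le n}d_k(\theta)\,\sigma_k\qquad(\theta\in\Theta).$$ (a) Let the data be random variables on the same probability space as the signs, and let the sequence of signs be independent of the data. Suppose that there is a non-random function $\gamma:\Theta\times\Theta\to\mathbb{R}$ with $\gamma(\theta,\theta)>0$ for all $\theta\in\Theta$ such that $\gamma_n(\theta_1,\theta_2)\to\gamma(\theta_1,\theta_2)$ in probability as $n\to\infty$, for all $\theta_1,\theta_2\in\Theta$, and that $$\limsup_{n\to\infty}\,n^{-1}\sum_{k\le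 n}E\left\{d_k(\theta)^2\,\mathbf{1}_{|d_k(\theta)|>\epsilon\sqrt n}\right\}=0\qquad(\theta\in\Theta,\ \epsilon>0).$$ Then there is a mean zero Gaussian process $Z=(Z(\theta))_{\theta\in\Theta}$ with covariance function $\gamma$, and the finite-dimensional distributions of $D_n^*$ converge weakly to those of $Z$ as $n\to\infty$. (b) The same conclusion holds conditionally on the data, that is, for any fixed (non-random) sequence of triplets $(x_{k1},x_{k2},y_k)$ and with respect to the distribution of the random signs $\sigma_k$ alone, provided that for some function $\gamma:\Theta\times\Theta\to\mathbb{R}$ with $\gamma(\theta,\theta)>0$ for all $\theta\in\Theta$ one has $\gamma_n(\theta_1,\theta_2)\to\gamma(\theta_1,\theta_2)$ as $n\to\infty$ for all $\theta_1,\theta_2\in\Theta$, and $$\limsup_{n\to\infty}\,n^{-1}\sum_{k\le n}d_k(\theta)^2\,\mathbf{1}_{|d_k(\theta)|>\epsilon\sqrt n}=0\qquad(\theta\in\Theta,\ \epsilon>0).$$ -/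

import Mathlib

open MeasureTheory ProbabilityTheory Filter Topology
open scoped ENNReal

noncomputable section

/-- The score differences `d_k(θ) = S_θ(x_{k1}, y_k) - S_θ(x_{k2}, y_k)` of two sequences of
forecasts `x₁`, `x₂` for the observations `y`. Time starts at `k = 0`. -/
def scoreDiff {Θ X Y : Type*} (S : Θ → X → Y → ℝ) (x₁ x₂ : ℕ → X) (y : ℕ → Y)
    (k : ℕ) (θ : Θ) : ℝ :=
  S θ (x₁ k) (y k) - S θ (x₂ k) (y k)

/-- The empirical covariance `γ_n(θ₁, θ₂) = n⁻¹ ∑ d_k(θ₁) d_k(θ₂)` of the first `n` functions in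
a sequence of functions `d_k` on `Θ`. -/
def empiricalCov {Θ : Type*} (d : ℕ → Θ → ℝ) (n : ℕ) (θ₁ θ₂ : Θ) : ℝ :=
  (n : ℝ)⁻¹ * ∑ k ∈ Finset.range n, d k θ₁ * d k θ₂

/-- The sign-randomized process `D_n^*(θ) = n^{-1/2} ∑ d_k(θ) s_k` with signs `s_k`, the sum
extending over the first `n` indices. -/
def signProcess {Θ : Type*} (d : ℕ → Θ → ℝ) (s : ℕ → ℝ) (n : ℕ) (θ : Θ) : ℝ :=
  (√(n : ℝ))⁻¹ * ∑ k ∈ Finset.range n, d k θ * s k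

/-- The random variables `σ_k` are independent and take the values `1` and `-1` with
probability `1/2` each. -/
structure IsRademacherSeq {Ω : Type*} [MeasurableSpace Ω] (P : Measure Ω)
    (σ : ℕ → Ω → ℝ) : Prop where
  measurable : ∀ k, Measurable (σ k)
  indep : iIndepFun σ P
  prob_one : ∀ k, P {ω | σ k ω = 1} = 1 / 2
  prob_neg_one : ∀ k, P {ω | σ k ω = -1} = 1 / 2

/-- The truncated square `a² 1{|a| > c}`, as an extended nonnegative number. -/
def sqTail (a c : ℝ) : ℝ≥0∞ :=
  open Classical in if c < |a| then ENNReal.ofReal (a ^ 2) else 0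

/-- The Lindeberg condition for random functions `d_k` on `Θ`:
`limsup_n n⁻¹ ∑ E {d_k(θ)² 1{|d_k(θ)| > ε √n}} = 0` for all `θ` and `ε > 0`. The expectations
take values in `[0, ∞]`. -/
def LindebergCondition {Θ Ω : Type*} [MeasurableSpace Ω] (P : Measure Ω)
    (d : ℕ → Θ → Ω → ℝ) : Prop :=
  ∀ (θ : Θ) (ε : ℝ), 0 < ε →
    limsup (fun n : ℕ ↦ (n : ℝ≥0∞)⁻¹ *
      ∑ k ∈ Finset.range n, ∫⁻ ω, sqTail (d k θ ω) (ε * √(n : ℝ)) ∂P) atTop = 0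

/-- The Lindeberg condition without the expectation sign, for non-random functions `d_k`. -/
def DataLindebergCondition {Θ : Type*} (d : ℕ → Θ → ℝ) : Prop :=
  ∀ (θ : Θ) (ε : ℝ), 0 < ε →
    limsup (fun n : ℕ ↦ (n : ℝ≥0∞)⁻¹ *
      ∑ k ∈ Finset.range n, sqTail (d k θ) (ε * √(n : ℝ))) atTop = 0

/-- There is a Gaussian process `Z` indexed by `Θ` with mean zero and covariance function `γ`, and
the finite-dimensional distributions of the processes `D n` under `P` converge weakly to those
of `Z` as `n → ∞`. -/
def FidiTendstoCenteredGaussian.{u, v} {Θ : Type u} {Ω : Type v} [MeasurableSpace Ω]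
    (P : Measure Ω) [IsProbabilityMeasure P] (D : ℕ → Θ → Ω → ℝ) (γ : Θ → Θ → ℝ) : Prop :=
  ∃ (Ω' : Type u) (_ : MeasurableSpace Ω') (P' : Measure Ω') (_ : IsProbabilityMeasure P')
    (Z : Θ → Ω' → ℝ),
    IsGaussianProcess Z P' ∧
    (∀ θ, ∫ ω, Z θ ω ∂P' = 0) ∧
    (∀ θ₁ θ₂, covariance (Z θ₁) (Z θ₂) P' = γ θ₁ θ₂) ∧
    ∀ I : Finset Θ,
      TendstoInDistribution (fun (n : ℕ) (ω : Ω) (θ : I) ↦ D n θ ω) atTop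
        (fun (ω : Ω') (θ : I) ↦ Z θ ω) (fun _ ↦ P) P'

end

/-! Conditionally on the data, a linear combination `∑ t θ * D n θ` is a signed sum `∑ x k * σ k`
with frozen coefficients, so its characteristic function is exactly `∏ cos (x k)`. Lindeberg's
comparison replaces each `cos x` by `exp (-x² / 2)`: the error is of order `x⁴` for small `x` and
`x²` otherwise, so the total error is at most `ε² ∑ x²` plus a Lindeberg tail. Hence the product is
close to `exp (-(∑ x²) / 2)`, and `∑ x²` is the quadratic form of the empirical covariance, which
converges to that of `γ`. Averaging over the data, which are independent of the signs, gives
convergence of characteristic functions (`tendsto_integral_prod_cos`), and Lévy's continuity theorem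
yields the weak limits.

The limit process has to be constructed. Quadratic forms of empirical covariances are sums of
squares, so `γ` is positive semidefinite; the Gaussian laws it defines are consistent, and
Kolmogorov's extension theorem, proved here by compactness, yields `Z`. Fixed data are the special
case of constant random data. -/

/-! ### Kolmogorov extension -/

/-- The content of a projective family of finite measures on compact metrizable spaces is
continuous at the empty set. -/
lemma projectiveFamilyContent_tendsto_zero {ι : Type*} {X : ι → Type*}
    [∀ i, TopologicalSpace (X i)] [∀ i, CompactSpace (X i)]
    [∀ i, TopologicalSpace.PseudoMetrizableSpace (X i)] [∀ i, SecondCountableTopology (X i)]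
    [∀ i, MeasurableSpace (X i)] [∀ i, BorelSpace (X i)]
    {Q : ∀ J : Finset ι, Measure (∀ j : J, X j)} [∀ J, IsFiniteMeasure (Q J)]
    (hQ : IsProjectiveMeasureFamily Q) {A : ℕ → Set (∀ i, X i)}
    (hA : ∀ n, A n ∈ measurableCylinders X) (hanti : Antitone A) (hempty : ⋂ n, A n = ∅) :
    Tendsto (fun n ↦ projectiveFamilyContent hQ (A n)) atTop (𝓝 0) := by
  rw [ENNReal.tendsto_atTop_zero]
  intro ε hε
  obtain ⟨δ, hδ, hδε⟩ := ENNReal.exists_pos_sum_of_countable' hε.ne' ℕ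
  have hcyl n : ∃ s S, MeasurableSet S ∧ A n = cylinder s S := (mem_measurableCylinders _).1 (hA n)
  choose s S hS hAS using hcyl
  have hreg n : ∃ F, F ⊆ S n ∧ IsClosed F ∧ Q (s n) (S n \ F) < δ n :=
    (hS n).exists_isClosed_sdiff_lt (measure_ne_top _ _) (hδ n).ne'
  choose F hFS hF hFδ using hreg
  have hK n : IsClosed (cylinder (s n) (F n)) :=
    (hF n).preimage (by fun_prop)
  have hKA n : cylinder (s n) (F n) ⊆ A n := by
    rw [hAS n]; exact Set.preimage_mono (hFS n)
  have hKC n : cylinder (s n) (F n) ∈ measurableCylinders X :=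
    cylinder_mem_measurableCylinders _ _ (hF n).measurableSet
  have hdiff n : A n \ cylinder (s n) (F n) = cylinder (s n) (S n \ F n) := by
    conv_lhs => rw [hAS n]
    rfl
  -- The full product is compact by Tychonoff, so finitely many of the inner closed cylinders
  -- already have empty intersection.
  obtain ⟨u, hu⟩ := isCompact_univ.elim_finite_subfamily_closed
    (fun n ↦ cylinder (s n) (F n)) hK (by
      rw [Set.univ_inter, ← Set.subset_empty_iff, ← hempty]
      exact Set.iInter_mono hKA)
  refine ⟨u.sup id, fun n hn ↦ ?_⟩
  -- A point of `A n` lies in every `A i` with `i ∈ u`, but must miss one of the closed cylinders.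
  -- So `A n` is covered by the approximation losses, whose total is below `ε`.
  have hsub : A n ⊆ ⋃ i ∈ u, A i \ cylinder (s i) (F i) := by
    intro x hx
    by_contra hx'
    have : x ∈ Set.univ ∩ ⋂ i ∈ u, cylinder (s i) (F i) := by
      refine ⟨trivial, Set.mem_iInter₂.2 fun i hi ↦ ?_⟩
      by_contra hxi
      exact hx' (Set.mem_biUnion hi ⟨hanti ((Finset.le_sup (f := id) hi).trans hn) hx, hxi⟩)
    rw [hu] at this
    exact this
  have hmem : ∀ i ∈ u, A i \ cylinder (s i) (F i) ∈ measurableCylinders X := fun i _ ↦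
    isSetRing_measurableCylinders.sdiff_mem (hA i) (hKC i)
  calc projectiveFamilyContent hQ (A n)
      ≤ projectiveFamilyContent hQ (⋃ i ∈ u, A i \ cylinder (s i) (F i)) :=
        projectiveFamilyContent_mono hQ (hA n)
          (isSetRing_measurableCylinders.biUnion_mem u hmem) hsub
    _ ≤ ∑ i ∈ u, projectiveFamilyContent hQ (A i \ cylinder (s i) (F i)) :=
        addContent_biUnion_le isSetRing_measurableCylinders hmem
    _ ≤ ∑ i ∈ u, δ i := by
        refine Finset.sum_le_sum fun i _ ↦ ?_
        rw [hdiff i, projectiveFamilyContent_cylinder hQ ((hS i).diff (hF i).measurableSet)]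
        exact (hFδ i).le
    _ ≤ ∑' i, δ i := ENNReal.sum_le_tsum u
    _ ≤ ε := hδε.le

/-- **Kolmogorov extension theorem** for compact metrizable spaces. -/
theorem MeasureTheory.IsProjectiveMeasureFamily.exists_isProjectiveLimit_of_compactSpace
    {ι : Type*} {X : ι → Type*}
    [∀ i, TopologicalSpace (X i)] [∀ i, CompactSpace (X i)]
    [∀ i, TopologicalSpace.PseudoMetrizableSpace (X i)] [∀ i, SecondCountableTopology (X i)]
    [∀ i, MeasurableSpace (X i)] [∀ i, BorelSpace (X i)]
    {Q : ∀ J : Finset ι, Measure (∀ j : J, X j)} [∀ J, IsFiniteMeasure (Q J)]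
    (hQ : IsProjectiveMeasureFamily Q) :
    ∃ μ : Measure (∀ i, X i), IsProjectiveLimit μ Q := by
  have hsub : (projectiveFamilyContent hQ).IsSigmaSubadditive :=
    isSigmaSubadditive_of_addContent_iUnion_eq_tsum
      isSetRing_measurableCylinders (fun f hf hUf hdisj ↦
        addContent_iUnion_eq_sum_of_tendsto_zero isSetRing_measurableCylinders _
          (fun s _ ↦ projectiveFamilyContent_ne_top hQ)
          (fun _ ↦ projectiveFamilyContent_tendsto_zero hQ) hf hUf hdisj)
  refine ⟨(projectiveFamilyContent hQ).measure isSetSemiring_measurableCylinders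
      generateFrom_measurableCylinders.ge hsub, fun I ↦ ?_⟩
  ext s hs
  rw [Measure.map_apply (Finset.measurable_restrict I) hs, AddContent.measure_eq,
    ← cylinder, projectiveFamilyContent_cylinder hQ hs]
  · exact generateFrom_measurableCylinders.symm
  · exact cylinder_mem_measurableCylinders _ _ hs

/-- **Kolmogorov extension theorem** for real-valued processes: every projective family of
probability measures is the family of finite-dimensional laws of some process. -/
theorem MeasureTheory.IsProjectiveMeasureFamily.exists_process.{u} {ι : Type u}
    {Q : ∀ J : Finset ι, Measure (J → ℝ)} [∀ J, IsProbabilityMeasure (Q J)]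
    (hQ : IsProjectiveMeasureFamily (α := fun _ ↦ ℝ) Q) :
    ∃ (Ω : Type u) (_ : MeasurableSpace Ω) (P : Measure Ω) (_ : IsProbabilityMeasure P)
      (Z : ι → Ω → ℝ), ∀ I : Finset ι, HasLaw (fun ω (i : I) ↦ Z i ω) (Q I) P := by
  -- The real line is embedded in the compact space `EReal`, where the extension exists. Coming back
  -- by `toReal` preserves the laws, since `toReal` inverts the embedding.
  have hmeas (J : Finset ι) : Measurable (fun (x : J → ℝ) (j : J) ↦ (x j : EReal)) :=
    measurable_pi_lambda _ fun j ↦ measurable_coe_real_ereal.comp (measurable_pi_apply j)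
  let R (J : Finset ι) : Measure (J → EReal) := (Q J).map (fun x j ↦ (x j : EReal))
  have hR_prob (J) : IsProbabilityMeasure (R J) :=
    Measure.isProbabilityMeasure_map (hmeas J).aemeasurable
  have hR : IsProjectiveMeasureFamily (α := fun _ ↦ EReal) R := by
    intro I J hJI
    change (Q J).map _ = ((Q I).map _).map (Finset.restrict₂ (π := fun _ ↦ EReal) hJI)
    rw [Measure.map_map (Finset.measurable_restrict₂ (X := fun _ ↦ EReal) hJI) (hmeas I),
      hQ I J hJI,
      Measure.map_map (hmeas J) (Finset.measurable_restrict₂ (X := fun _ ↦ ℝ) hJI)]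
    rfl
  obtain ⟨μ, hμ⟩ := hR.exists_isProjectiveLimit_of_compactSpace
  refine ⟨ι → EReal, inferInstance, μ, hμ.isProbabilityMeasure, fun i ω ↦ (ω i).toReal,
    fun I ↦ ⟨?_, ?_⟩⟩
  · exact (measurable_pi_lambda _ fun i ↦
      measurable_ereal_toReal.comp (measurable_pi_apply _)).aemeasurable
  · have hm : Measurable (fun (x : I → EReal) (i : I) ↦ (x i).toReal) :=
      measurable_pi_lambda _ fun i ↦ measurable_ereal_toReal.comp (measurable_pi_apply i)
    have : (fun (ω : ι → EReal) (i : I) ↦ (ω i).toReal) =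
        (fun (x : I → EReal) (i : I) ↦ (x i).toReal) ∘ I.restrict := rfl
    rw [this, ← Measure.map_map hm (Finset.measurable_restrict I), hμ I,
      Measure.map_map hm (hmeas I)]
    simp [Function.comp_def]

/-! ### Gaussian processes with given covariance -/

/-- The centered Gaussian measure on `I → ℝ` with covariance function `γ`. -/
noncomputable def gaussianFamily {Θ : Type*} (γ : Θ → Θ → ℝ) (I : Finset Θ) : Measure (I → ℝ) :=
  open Classical in
  (multivariateGaussian (0 : EuclideanSpace ℝ I) (Matrix.of fun s t : I ↦ γ s t)).map
    (MeasurableEquiv.toLp 2 (I → ℝ)).symm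

instance {Θ : Type*} (γ : Θ → Θ → ℝ) (I : Finset Θ) : IsGaussian (gaussianFamily γ I) := by
  classical
  rw [gaussianFamily,
    show ⇑(MeasurableEquiv.toLp 2 (I → ℝ)).symm = ⇑(EuclideanSpace.equiv I ℝ) from rfl]
  infer_instance

/-- Marginals of a multivariate Gaussian are Gaussian with the corresponding submatrix as
covariance. -/
lemma isProjectiveMeasureFamily_gaussianFamily {Θ : Type*} {γ : Θ → Θ → ℝ}
    (hγ : ∀ I : Finset Θ, (Matrix.of fun s t : I ↦ γ s t).PosSemidef) :
    IsProjectiveMeasureFamily (α := fun _ ↦ ℝ) (gaussianFamily γ) := by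
  classical
  intro I J hJI
  simp only [gaussianFamily]
  rw [Measure.map_map (Finset.measurable_restrict₂ (X := fun _ ↦ ℝ) hJI)
    (MeasurableEquiv.measurable _)]
  have : (Finset.restrict₂ (π := fun _ ↦ ℝ) hJI ∘ (MeasurableEquiv.toLp 2 (I → ℝ)).symm) =
      (MeasurableEquiv.toLp 2 (J → ℝ)).symm ∘ (EuclideanSpace.restrict₂ hJI) := by ext; simp
  rw [this, ← Measure.map_map (MeasurableEquiv.measurable _) (by fun_prop)]
  congr 1
  rw [(measurePreserving_restrict₂_multivariateGaussian (hγ I) hJI).map_eq, map_zero]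
  rfl

/-- For every positive semidefinite `γ` there is a centered Gaussian process with covariance
function `γ`. -/
theorem exists_isGaussianProcess.{u} {Θ : Type u} {γ : Θ → Θ → ℝ}
    (hγ : ∀ I : Finset Θ, (Matrix.of fun s t : I ↦ γ s t).PosSemidef) :
    ∃ (Ω : Type u) (_ : MeasurableSpace Ω) (P : Measure Ω) (_ : IsProbabilityMeasure P)
      (Z : Θ → Ω → ℝ), IsGaussianProcess Z P ∧ (∀ θ, ∫ ω, Z θ ω ∂P = 0) ∧
      (∀ θ₁ θ₂, covariance (Z θ₁) (Z θ₂) P = γ θ₁ θ₂) ∧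
      ∀ I : Finset Θ, HasLaw (fun ω (θ : I) ↦ Z θ ω) (gaussianFamily γ I) P := by
  classical
  obtain ⟨Ω, _, P, hP, Z, hZ⟩ := (isProjectiveMeasureFamily_gaussianFamily hγ).exists_process
  refine ⟨Ω, _, P, hP, Z, ⟨fun I ↦ (hZ I).hasGaussianLaw⟩, fun θ ↦ ?_, fun θ₁ θ₂ ↦ ?_, hZ⟩
  · have h := (hZ {θ}).integral_comp (f := fun x : ({θ} : Finset Θ) → ℝ ↦ x ⟨θ, by simp⟩)
      (Measurable.aestronglyMeasurable (by fun_prop))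
    simp only [Function.comp_def] at h
    rw [h, gaussianFamily, integral_map_equiv]
    have : (fun x : EuclideanSpace ℝ ({θ} : Finset Θ) ↦
        (MeasurableEquiv.toLp 2 (({θ} : Finset Θ) → ℝ)).symm x ⟨θ, by simp⟩) =
        fun x ↦ EuclideanSpace.proj (𝕜 := ℝ) (⟨θ, by simp⟩ : ({θ} : Finset Θ)) x := rfl
    rw [this, ContinuousLinearMap.integral_comp_id_comm IsGaussian.integrable_id,
      integral_id_multivariateGaussian, map_zero]
  · have h := (hZ {θ₁, θ₂}).covariance_fun_comp
      (f := fun x : ({θ₁, θ₂} : Finset Θ) → ℝ ↦ x ⟨θ₁, by simp⟩) (g := fun x ↦ x ⟨θ₂, by simp⟩)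
      (Measurable.aemeasurable (by fun_prop)) (Measurable.aemeasurable (by fun_prop))
    refine h.trans ?_
    rw [gaussianFamily, covariance_map_equiv]
    exact covariance_eval_multivariateGaussian (hγ _) _ _

/-! ### Comparing cosines with Gaussian factors; truncated squares -/

/-- Both terms lie between `1 - x² / 2` and `1`. -/
lemma abs_cos_sub_exp_le_sq (x : ℝ) : |Real.cos x - Real.exp (-(x ^ 2 / 2))| ≤ x ^ 2 := by
  have h1 := Real.one_sub_sq_div_two_le_cos (x := x)
  have h2 := Real.cos_le_one x
  have h3 := Real.add_one_le_exp (-(x ^ 2 / 2))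
  have h4 : Real.exp (-(x ^ 2 / 2)) ≤ 1 := Real.exp_le_one_iff.2 (by nlinarith [sq_nonneg x])
  rw [abs_le]
  constructor <;> nlinarith [sq_nonneg x]

/-- The Taylor expansions agree up to `1 - x² / 2`; for `|x| > 1` the quadratic bound is already
stronger. -/
lemma abs_cos_sub_exp_le_pow_four (x : ℝ) :
    |Real.cos x - Real.exp (-(x ^ 2 / 2))| ≤ x ^ 4 := by
  rcases le_or_gt |x| 1 with hx | hx
  · have h1 := abs_le.1 (Real.cos_bound hx)
    have h4 : |x| ^ 4 = x ^ 4 := (even_two_mul 2).pow_abs x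
    rw [h4] at h1
    have h3 := Real.add_one_le_exp (-(x ^ 2 / 2))
    have h5 : Real.exp (-(x ^ 2 / 2)) * (1 + x ^ 2 / 2) ≤ 1 := by
      have := Real.add_one_le_exp (x ^ 2 / 2)
      calc _ ≤ Real.exp (-(x ^ 2 / 2)) * Real.exp (x ^ 2 / 2) := by gcongr; linarith
        _ = 1 := by rw [← Real.exp_add]; simp
    -- With `u = x² / 2`, this follows from `exp (-u) * (1 + u) ≤ 1 ≤ 1 + u³ = (1 - u + u²) * (1 +
    -- u)`.
    have h6 : Real.exp (-(x ^ 2 / 2)) ≤ 1 - x ^ 2 / 2 + x ^ 4 / 4 := by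
      have hpos : 0 < 1 + x ^ 2 / 2 := by positivity
      refine le_of_mul_le_mul_right (h5.trans ?_) hpos
      have : 0 ≤ x ^ 6 := by positivity
      nlinarith
    have : 0 ≤ x ^ 4 := by positivity
    rw [abs_le]
    constructor <;> linarith [h1.1, h1.2]
  · refine (abs_cos_sub_exp_le_sq x).trans ?_
    have : 1 ≤ x ^ 2 := (one_le_sq_iff_one_le_abs x).2 hx.le
    nlinarith

lemma measurable_sqTail (c : ℝ) : Measurable fun a ↦ sqTail a c := by
  unfold sqTail
  exact Measurable.ite (measurableSet_lt measurable_const (by fun_prop)) (by fun_prop)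
    measurable_const

/-- Lindeberg's splitting: for `|x| ≤ ε` the quartic bound gives `x⁴ ≤ ε² x²`, and beyond `ε` the
quadratic bound is the truncated square itself. -/
lemma ofReal_abs_cos_sub_exp_le (x ε : ℝ) :
    ENNReal.ofReal |Real.cos x - Real.exp (-(x ^ 2 / 2))| ≤
      ENNReal.ofReal (ε ^ 2 * x ^ 2) + sqTail x ε := by
  unfold sqTail
  split_ifs with h
  · exact (ENNReal.ofReal_le_ofReal (abs_cos_sub_exp_le_sq x)).trans le_add_self
  · rw [add_zero]
    refine ENNReal.ofReal_le_ofReal ((abs_cos_sub_exp_le_pow_four x).trans ?_)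
    have : x ^ 2 ≤ ε ^ 2 := sq_le_sq.2 ((not_lt.1 h).trans (le_abs_self ε))
    nlinarith [sq_nonneg x]

/-- Telescoping: factors are exchanged one at a time, the remaining ones being bounded by `1`. -/
lemma abs_prod_sub_prod_le {ι : Type*} (s : Finset ι) {a b : ι → ℝ} (ha : ∀ i ∈ s, |a i| ≤ 1)
    (hb : ∀ i ∈ s, |b i| ≤ 1) : |∏ i ∈ s, a i - ∏ i ∈ s, b i| ≤ ∑ i ∈ s, |a i - b i| := by
  classical
  induction s using Finset.induction with
  | empty => simp
  | insert i s hi ih =>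
    rw [Finset.prod_insert hi, Finset.prod_insert hi, Finset.sum_insert hi]
    have ih := ih (fun j hj ↦ ha j (Finset.mem_insert_of_mem hj))
      (fun j hj ↦ hb j (Finset.mem_insert_of_mem hj))
    have hP : |∏ j ∈ s, a j| ≤ 1 := by
      rw [Finset.abs_prod]
      exact Finset.prod_le_one (fun _ _ ↦ abs_nonneg _)
        (fun j hj ↦ ha j (Finset.mem_insert_of_mem hj))
    calc |a i * ∏ j ∈ s, a j - b i * ∏ j ∈ s, b j|
        = |(a i - b i) * ∏ j ∈ s, a j + b i * (∏ j ∈ s, a j - ∏ j ∈ s, b j)| := by ring_nf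
      _ ≤ |a i - b i| * |∏ j ∈ s, a j| + |b i| * |∏ j ∈ s, a j - ∏ j ∈ s, b j| := by
        rw [← abs_mul, ← abs_mul]; exact abs_add_le _ _
      _ ≤ |a i - b i| * 1 + 1 * ∑ j ∈ s, |a j - b j| := by
        gcongr
        exact hb i (Finset.mem_insert_self i s)
      _ = _ := by ring

lemma ofReal_abs_prod_cos_sub_exp_le {ι : Type*} (s : Finset ι) (x : ι → ℝ) (ε : ℝ) :
    ENNReal.ofReal |∏ k ∈ s, Real.cos (x k) - Real.exp (-((∑ k ∈ s, x k ^ 2) / 2))| ≤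
      ENNReal.ofReal (ε ^ 2 * ∑ k ∈ s, x k ^ 2) + ∑ k ∈ s, sqTail (x k) ε := by
  have hexp : Real.exp (-((∑ k ∈ s, x k ^ 2) / 2)) = ∏ k ∈ s, Real.exp (-(x k ^ 2 / 2)) := by
    rw [← Real.exp_sum, Finset.sum_neg_distrib, Finset.sum_div]
  calc _ ≤ ENNReal.ofReal (∑ k ∈ s, |Real.cos (x k) - Real.exp (-(x k ^ 2 / 2))|) := by
        rw [hexp]
        refine ENNReal.ofReal_le_ofReal (abs_prod_sub_prod_le s
          (fun _ _ ↦ Real.abs_cos_le_one _) fun k _ ↦ ?_)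
        rw [Real.abs_exp]
        exact Real.exp_le_one_iff.2 (by nlinarith [sq_nonneg (x k)])
    _ = ∑ k ∈ s, ENNReal.ofReal |Real.cos (x k) - Real.exp (-(x k ^ 2 / 2))| :=
        ENNReal.ofReal_sum_of_nonneg fun _ _ ↦ abs_nonneg _
    _ ≤ ∑ k ∈ s, (ENNReal.ofReal (ε ^ 2 * x k ^ 2) + sqTail (x k) ε) :=
        Finset.sum_le_sum fun k _ ↦ ofReal_abs_cos_sub_exp_le _ _
    _ = _ := by
        rw [Finset.sum_add_distrib, Finset.mul_sum,
          ENNReal.ofReal_sum_of_nonneg fun _ _ ↦ by positivity]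

lemma sqTail_mul {c : ℝ} (hc : 0 < c) (a ε : ℝ) :
    sqTail (c * a) ε = ENNReal.ofReal (c ^ 2) * sqTail a (ε / c) := by
  have : ε / c < |a| ↔ ε < |c * a| := by
    rw [abs_mul, abs_of_pos hc, div_lt_iff₀' hc]
  simp only [sqTail, this]
  split_ifs
  · rw [← ENNReal.ofReal_mul (by positivity), mul_pow]
  · simp

/-- The truncated square of a linear combination is bounded by the sum of the truncated squares
of its terms. -/
lemma sqTail_sum_mul_le {ι : Type*} (s : Finset ι) (t a : ι → ℝ) (c : ℝ) :
    sqTail (∑ i ∈ s, t i * a i) c ≤ ENNReal.ofReal ((1 + ∑ i ∈ s, |t i|) ^ 2) *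
      ∑ i ∈ s, sqTail (a i) (c / (1 + ∑ i ∈ s, |t i|)) := by
  -- The summand `1` keeps `M` positive when all `t i` vanish, so that the threshold can be divided
  -- by it.
  set M := 1 + ∑ i ∈ s, |t i| with hM
  have hsum : 0 ≤ ∑ i ∈ s, |t i| := Finset.sum_nonneg fun _ _ ↦ abs_nonneg _
  have hMpos : 0 < M := by linarith
  rcases s.eq_empty_or_nonempty with rfl | hs
  · simp [sqTail]
  -- The combination is at most `M` times its largest entry in absolute value, and truncated squares
  -- increase with the absolute value; one term then suffices.
  obtain ⟨j, hj, hmax⟩ := s.exists_max_image (fun i ↦ |a i|) hs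
  have hle : |∑ i ∈ s, t i * a i| ≤ M * |a j| :=
    calc |∑ i ∈ s, t i * a i| ≤ ∑ i ∈ s, |t i * a i| := Finset.abs_sum_le_sum_abs _ _
      _ ≤ ∑ i ∈ s, |t i| * |a j| := Finset.sum_le_sum fun i hi ↦ by
        rw [abs_mul]; exact mul_le_mul_of_nonneg_left (hmax i hi) (abs_nonneg _)
      _ = (∑ i ∈ s, |t i|) * |a j| := by rw [Finset.sum_mul]
      _ ≤ M * |a j| := by gcongr; linarith
  calc sqTail (∑ i ∈ s, t i * a i) c ≤ sqTail (M * a j) c := by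
        have hle' : |∑ i ∈ s, t i * a i| ≤ |M * a j| := by rwa [abs_mul, abs_of_pos hMpos]
        unfold sqTail
        split_ifs with h1 h2
        · exact ENNReal.ofReal_le_ofReal (sq_le_sq.2 hle')
        · exact absurd (h1.trans_le hle') h2
        · exact zero_le
        · exact zero_le
    _ = ENNReal.ofReal (M ^ 2) * sqTail (a j) (c / M) := sqTail_mul hMpos _ _
    _ ≤ _ := by
        gcongr
        exact Finset.single_le_sum (f := fun i ↦ sqTail (a i) (c / M)) (fun _ _ ↦ zero_le) hj

/-! ### Convergence in probability and the Lindeberg argument -/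

section InMeasure

variable {Ω : Type*} [MeasurableSpace Ω] {P : Measure Ω}

lemma MeasureTheory.TendstoInMeasure.add {f f' : ℕ → Ω → ℝ} {g g' : Ω → ℝ}
    (h : TendstoInMeasure P f atTop g) (h' : TendstoInMeasure P f' atTop g') :
    TendstoInMeasure P (fun n ω ↦ f n ω + f' n ω) atTop (fun ω ↦ g ω + g' ω) := by
  rw [tendstoInMeasure_iff_norm] at h h' ⊢
  intro ε hε
  have hadd := (h (ε / 2) (half_pos hε)).add (h' (ε / 2) (half_pos hε))
  rw [add_zero] at hadd
  refine tendsto_of_tendsto_of_tendsto_of_le_of_le tendsto_const_nhds hadd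
    (fun _ ↦ zero_le) fun n ↦ (measure_mono ?_).trans (measure_union_le _ _)
  intro ω hω
  by_contra hcon
  simp only [Set.mem_union, Set.mem_ofPred_eq, not_or, not_le, Real.norm_eq_abs] at hcon hω
  have := abs_add_le (f n ω - g ω) (f' n ω - g' ω)
  rw [sub_add_sub_comm] at this
  linarith [hcon.1, hcon.2]

lemma MeasureTheory.TendstoInMeasure.const_mul {f : ℕ → Ω → ℝ} {g : Ω → ℝ}
    (h : TendstoInMeasure P f atTop g) (c : ℝ) :
    TendstoInMeasure P (fun n ω ↦ c * f n ω) atTop (fun ω ↦ c * g ω) := by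
  rw [tendstoInMeasure_iff_norm] at h ⊢
  intro ε hε
  have hc : 0 < |c| + 1 := by positivity
  refine tendsto_of_tendsto_of_tendsto_of_le_of_le tendsto_const_nhds
    (h (ε / (|c| + 1)) (div_pos hε hc)) (fun _ ↦ zero_le) fun n ↦ measure_mono ?_
  intro ω hω
  simp only [Set.mem_ofPred_eq, Real.norm_eq_abs] at hω ⊢
  rw [← mul_sub, abs_mul] at hω
  rw [div_le_iff₀ hc]
  nlinarith [abs_nonneg (f n ω - g ω)]

lemma MeasureTheory.TendstoInMeasure.finset_sum {ι : Type*} (s : Finset ι)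
    {f : ι → ℕ → Ω → ℝ} {g : ι → Ω → ℝ} (h : ∀ i ∈ s, TendstoInMeasure P (f i) atTop (g i)) :
    TendstoInMeasure P (fun n ω ↦ ∑ i ∈ s, f i n ω) atTop (fun ω ↦ ∑ i ∈ s, g i ω) := by
  classical
  induction s using Finset.induction with
  | empty =>
    simp only [Finset.sum_empty]
    intro ε hε
    simp [hε.ne']
  | insert i s hi ih =>
    simp only [Finset.sum_insert hi]
    exact (h i (Finset.mem_insert_self i s)).add
      (ih fun j hj ↦ h j (Finset.mem_insert_of_mem hj))

variable [IsProbabilityMeasure P]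

lemma MeasureTheory.TendstoInMeasure.nonneg {V : ℕ → Ω → ℝ} {v : ℝ}
    (h : TendstoInMeasure P V atTop (fun _ ↦ v)) (hV : ∀ n ω, 0 ≤ V n ω) : 0 ≤ v := by
  obtain ⟨ns, -, hns⟩ := h.exists_seq_tendsto_ae
  obtain ⟨ω, hω⟩ := hns.exists
  exact ge_of_tendsto' hω fun _ ↦ hV _ ω

/-- Convergence in probability implies convergence in distribution, here to the Dirac mass at `v`.
-/
lemma MeasureTheory.TendstoInMeasure.tendsto_integral_comp {V : ℕ → Ω → ℝ} {v : ℝ}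
    (h : TendstoInMeasure P V atTop (fun _ ↦ v)) (hV : ∀ n, Measurable (V n)) {g : ℝ → ℝ}
    (hg : Continuous g) {C : ℝ} (hC : ∀ x, |g x| ≤ C) :
    Tendsto (fun n ↦ ∫ ω, g (V n ω) ∂P) atTop (𝓝 (g v)) := by
  have hd := ProbabilityMeasure.tendsto_iff_forall_integral_tendsto.1
    (h.tendstoInDistribution fun n ↦ (hV n).aemeasurable).tendsto
  have := hd (BoundedContinuousFunction.ofNormedAddCommGroup g hg C hC)
  simp only [ProbabilityMeasure.coe_mk, BoundedContinuousFunction.coe_ofNormedAddCommGroup] at this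
  rw [integral_map (by fun_prop) hg.aestronglyMeasurable] at this
  simp_rw [integral_map (hV _).aemeasurable hg.aestronglyMeasurable] at this
  simpa using this

/-- The Lindeberg argument: if the row sums of squares of a triangular array converge in
probability to a constant `v` and the array satisfies the Lindeberg condition, then the mean of
the products of the cosines of each row converges to `exp (-v / 2)`. -/
lemma tendsto_integral_prod_cos {x : ℕ → ℕ → Ω → ℝ} (hx : ∀ n k, Measurable (x n k)) {v : ℝ}
    (hv : TendstoInMeasure P (fun n ω ↦ ∑ k ∈ Finset.range n, x n k ω ^ 2) atTop (fun _ ↦ v))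
    (hL : ∀ ε : ℝ, 0 < ε →
      Tendsto (fun n ↦ ∑ k ∈ Finset.range n, ∫⁻ ω, sqTail (x n k ω) ε ∂P) atTop (𝓝 0)) :
    Tendsto (fun n ↦ ∫ ω, ∏ k ∈ Finset.range n, Real.cos (x n k ω) ∂P) atTop
      (𝓝 (Real.exp (-(v / 2)))) := by
  set V : ℕ → Ω → ℝ := fun n ω ↦ ∑ k ∈ Finset.range n, x n k ω ^ 2 with hVdef
  have hV n : Measurable (V n) := by fun_prop
  have hV0 n ω : 0 ≤ V n ω := Finset.sum_nonneg fun _ _ ↦ sq_nonneg _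
  have hv0 : 0 ≤ v := hv.nonneg hV0
  set W : ℕ → Ω → ℝ := fun n ω ↦ ∏ k ∈ Finset.range n, Real.cos (x n k ω) with hWdef
  have hW n : Measurable (W n) := by
    refine Finset.measurable_fun_prod _ fun k _ ↦ by fun_prop
  have hW1 n ω : |W n ω| ≤ 1 := by
    simp only [hWdef, Finset.abs_prod]
    exact Finset.prod_le_one (fun _ _ ↦ abs_nonneg _) fun _ _ ↦ Real.abs_cos_le_one _
  have hG1 n ω : |Real.exp (-(V n ω / 2))| ≤ 1 := by
    rw [Real.abs_exp]
    exact Real.exp_le_one_iff.2 (by linarith [hV0 n ω])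
  have hWint n : Integrable (W n) P :=
    Integrable.of_bound (hW n).aestronglyMeasurable 1 (ae_of_all _ (hW1 n))
  have hGint n : Integrable (fun ω ↦ Real.exp (-(V n ω / 2))) P :=
    Integrable.of_bound (Measurable.aestronglyMeasurable (by fun_prop)) 1 (ae_of_all _ (hG1 n))
  have hG : Tendsto (fun n ↦ ∫ ω, Real.exp (-(V n ω / 2)) ∂P) atTop
      (𝓝 (Real.exp (-(v / 2)))) := by
    -- The absolute value makes the test function bounded on all of `ℝ`; it changes nothing on the
    -- nonnegative `V n` and `v`.
    have := hv.tendsto_integral_comp hV (g := fun y ↦ Real.exp (-(|y| / 2))) (by fun_prop)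
      (C := 1) (fun y ↦ by
        rw [Real.abs_exp]; exact Real.exp_le_one_iff.2 (by linarith [abs_nonneg y]))
    have hVabs n ω : |V n ω| = V n ω := abs_of_nonneg (hV0 n ω)
    simpa only [hVabs, ← hVdef, abs_of_nonneg hv0] using this
  have hdiff : Tendsto (fun n ↦ ∫⁻ ω, ENNReal.ofReal |W n ω - Real.exp (-(V n ω / 2))| ∂P)
      atTop (𝓝 0) := by
    rw [ENNReal.tendsto_nhds_zero]
    intro η hη
    obtain ⟨ε, hεη, hε⟩ : ∃ ε : ℝ, ENNReal.ofReal (ε ^ 2 * v) < η ∧ 0 < ε := by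
      have : Tendsto (fun ε : ℝ ↦ ENNReal.ofReal (ε ^ 2 * v)) (𝓝[>] 0) (𝓝 0) := by
        have hc : Continuous (fun ε : ℝ ↦ ENNReal.ofReal (ε ^ 2 * v)) :=
          ENNReal.continuous_ofReal.comp (by fun_prop)
        simpa using (hc.tendsto 0).mono_left nhdsWithin_le_nhds
      exact ((this.eventually_lt_const hη).and self_mem_nhdsWithin).exists
    -- Convergence in probability controls means of bounded functions only. Capping at `2` is
    -- harmless because the difference being estimated never exceeds `2`.
    have hmin := hv.tendsto_integral_comp hV (g := fun y ↦ min 2 |ε ^ 2 * y|) (by fun_prop)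
      (C := 2) (fun y ↦ by
        rw [abs_of_nonneg (le_min zero_le_two (abs_nonneg _))]; exact min_le_left _ _)
    have hlim := ((ENNReal.continuous_ofReal.tendsto _).comp hmin).add (hL ε hε)
    have hlt : ENNReal.ofReal (min 2 |ε ^ 2 * v|) + 0 < η := by
      rw [add_zero, abs_of_nonneg (by positivity)]
      exact (ENNReal.ofReal_le_ofReal (min_le_right _ _)).trans_lt hεη
    filter_upwards [hlim.eventually_lt_const hlt] with n hn
    refine le_trans ?_ hn.le
    have hmint : Integrable (fun ω ↦ min 2 |ε ^ 2 * V n ω|) P :=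
      Integrable.of_bound (Measurable.aestronglyMeasurable (by fun_prop)) 2
        (ae_of_all _ fun ω ↦ by
          rw [Real.norm_eq_abs, abs_of_nonneg (le_min zero_le_two (abs_nonneg _))]
          exact min_le_left _ _)
    have hsq : ∀ k ∈ Finset.range n, Measurable fun ω ↦ sqTail (x n k ω) ε :=
      fun k _ ↦ (measurable_sqTail ε).comp (hx n k)
    simp only [Function.comp_apply]
    rw [ofReal_integral_eq_lintegral_ofReal hmint
        (ae_of_all _ fun ω ↦ le_min zero_le_two (abs_nonneg _)),
      ← lintegral_finsetSum _ hsq,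
      ← lintegral_add_left (by fun_prop)]
    refine lintegral_mono fun ω ↦ ?_
    have hab := ofReal_abs_prod_cos_sub_exp_le (Finset.range n) (fun k ↦ x n k ω) ε
    have h2 : |W n ω - Real.exp (-(V n ω / 2))| ≤ 2 := by
      have := abs_sub (W n ω) (Real.exp (-(V n ω / 2)))
      linarith [hW1 n ω, hG1 n ω]
    rw [abs_of_nonneg (mul_nonneg (sq_nonneg ε) (hV0 n ω))]
    rcases le_total 2 (ε ^ 2 * V n ω) with h | h
    · rw [min_eq_left h]
      exact (ENNReal.ofReal_le_ofReal h2).trans le_self_add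
    · rw [min_eq_right h]
      exact hab
  have hsub : Tendsto (fun n ↦ ∫ ω, (W n ω - Real.exp (-(V n ω / 2))) ∂P) atTop (𝓝 0) := by
    refine squeeze_zero_norm (fun n ↦ ?_)
      ((ENNReal.tendsto_toReal ENNReal.zero_ne_top).comp hdiff)
    exact norm_integral_le_lintegral_norm _
  have := hsub.add hG
  rw [zero_add] at this
  refine this.congr fun n ↦ ?_
  rw [integral_sub (hWint n) (hGint n), sub_add_cancel]

end InMeasure

/-! ### Characteristic functions of signed sums -/

section Signs

variable {Ω : Type*} [MeasurableSpace Ω] {P : Measure Ω} [IsProbabilityMeasure P]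
  {σ : ℕ → Ω → ℝ}

/-- The two atoms exhaust the total mass `1`, so the law is its restriction to them. -/
lemma IsRademacherSeq.map_eq (hσ : IsRademacherSeq P σ) (k : ℕ) :
    P.map (σ k) = (1 / 2 : ℝ≥0∞) • Measure.dirac 1 + (1 / 2 : ℝ≥0∞) • Measure.dirac (-1) := by
  have hm := hσ.measurable k
  have : IsProbabilityMeasure (P.map (σ k)) := Measure.isProbabilityMeasure_map hm.aemeasurable
  have h1 : P.map (σ k) {1} = 1 / 2 := by
    rw [Measure.map_apply hm (measurableSet_singleton _)]
    exact hσ.prob_one k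
  have h2 : P.map (σ k) {-1} = 1 / 2 := by
    rw [Measure.map_apply hm (measurableSet_singleton _)]
    exact hσ.prob_neg_one k
  have hdisj : Disjoint ({1} : Set ℝ) {-1} := by
    rw [Set.disjoint_singleton]
    norm_num
  have hprob : P.map (σ k) ({1} ∪ {-1}) = 1 := by
    rw [measure_union hdisj (measurableSet_singleton _), h1, h2, ENNReal.add_halves]
  have hae : ∀ᵐ x ∂(P.map (σ k)), x ∈ ({1} ∪ {-1} : Set ℝ) :=
    (mem_ae_iff_prob_eq_one ((measurableSet_singleton _).union (measurableSet_singleton _))).2 hprob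
  rw [← Measure.restrict_eq_self_of_ae_mem hae,
    Measure.restrict_union hdisj (measurableSet_singleton _), Measure.restrict_singleton,
    Measure.restrict_singleton, h1, h2]

lemma IsRademacherSeq.charFun_map (hσ : IsRademacherSeq P σ) (k : ℕ) (t : ℝ) :
    charFun (P.map (σ k)) t = Real.cos t := by
  have h1 (x : ℝ) : Integrable (fun y : ℝ ↦ Complex.exp (t * y * Complex.I))
      ((1 / 2 : ℝ≥0∞) • Measure.dirac x) :=
    (integrable_dirac (by simp)).smul_measure (by simp)
  rw [charFun_apply_real, hσ.map_eq k, integral_add_measure (h1 _) (h1 _), integral_smul_measure,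
    integral_smul_measure, integral_dirac, integral_dirac, Complex.ofReal_cos, Complex.cos]
  simp
  ring

lemma IsRademacherSeq.integral_exp_sum (hσ : IsRademacherSeq P σ) (n : ℕ) (b : ℕ → ℝ) :
    ∫ ω, Complex.exp ((∑ k ∈ Finset.range n, b k * σ k ω : ℝ) * Complex.I) ∂P =
      (∏ k ∈ Finset.range n, Real.cos (b k) : ℝ) := by
  have hind : iIndepFun (fun k ω ↦ b k * σ k ω) P :=
    hσ.indep.comp (fun k x ↦ b k * x) fun k ↦ by fun_prop
  have hm k : Measurable (fun ω ↦ b k * σ k ω) := (hσ.measurable k).const_mul _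
  have h := congrFun ((hind.restrict (Finset.range n)).charFun_map_fun_finsetSum_eq_prod
    (fun k _ ↦ (hm k).aemeasurable)) 1
  rw [charFun_apply_real, integral_map
    (Finset.measurable_fun_sum _ fun k _ ↦ hm k).aemeasurable (by fun_prop)] at h
  simp only [Complex.ofReal_one, one_mul, Finset.prod_apply] at h
  rw [h, Complex.ofReal_prod]
  refine Finset.prod_congr rfl fun k _ ↦ ?_
  rw [charFun_map_mul_comp (hσ.measurable k).aemeasurable, hσ.charFun_map, mul_one]

/-- Averaging over the signs: if the coefficients `b` are independent of the signs, then the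
characteristic function of the signed sum is the mean of a product of cosines. -/
lemma IsRademacherSeq.integral_exp_sum_of_indepFun (hσ : IsRademacherSeq P σ) (n : ℕ)
    {b : Ω → ℕ → ℝ} (hb : Measurable b) (hind : IndepFun b (fun ω k ↦ σ k ω) P) :
    ∫ ω, Complex.exp ((∑ k ∈ Finset.range n, b ω k * σ k ω : ℝ) * Complex.I) ∂P =
      (∫ ω, ∏ k ∈ Finset.range n, Real.cos (b ω k) ∂P : ℝ) := by
  -- By independence the joint law is a product, so Fubini reduces the claim to deterministic
  -- coefficients, the case of `integral_exp_sum`.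
  have hσm : Measurable (fun ω k ↦ σ k ω) := measurable_pi_lambda _ hσ.measurable
  have hmap := (indepFun_iff_map_prod_eq_prod_map_map hb.aemeasurable hσm.aemeasurable).1 hind
  have : IsProbabilityMeasure (P.map b) := Measure.isProbabilityMeasure_map hb.aemeasurable
  have : IsProbabilityMeasure (P.map fun ω k ↦ σ k ω) :=
    Measure.isProbabilityMeasure_map hσm.aemeasurable
  let F : (ℕ → ℝ) × (ℕ → ℝ) → ℂ := fun p ↦
    Complex.exp ((∑ k ∈ Finset.range n, p.1 k * p.2 k : ℝ) * Complex.I)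
  have hF : Measurable F := by
    simp only [F]
    fun_prop
  have hFint : Integrable F ((P.map b).prod (P.map fun ω k ↦ σ k ω)) :=
    Integrable.of_bound hF.aestronglyMeasurable 1
      (ae_of_all _ fun p ↦ (Complex.norm_exp_ofReal_mul_I _).le)
  calc _ = ∫ ω, F (b ω, fun k ↦ σ k ω) ∂P := rfl
    _ = ∫ p, F p ∂(P.map fun ω ↦ (b ω, fun k ↦ σ k ω)) :=
        (integral_map (hb.prodMk hσm).aemeasurable hF.aestronglyMeasurable).symm
    _ = ∫ x, ∫ s, F (x, s) ∂(P.map fun ω k ↦ σ k ω) ∂(P.map b) := by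
        rw [hmap, integral_prod _ hFint]
    _ = ∫ x, ((∏ k ∈ Finset.range n, Real.cos (x k) : ℝ) : ℂ) ∂(P.map b) := by
        congr with x
        exact (integral_map hσm.aemeasurable
          (hF.comp measurable_prodMk_left).aestronglyMeasurable).trans (hσ.integral_exp_sum n x)
    _ = ∫ ω, ((∏ k ∈ Finset.range n, Real.cos (b ω k) : ℝ) : ℂ) ∂P := by
        rw [integral_map hb.aemeasurable]
        exact (Complex.measurable_ofReal.comp
          (Finset.measurable_fun_prod _ fun k _ ↦ by fun_prop)).aestronglyMeasurable
    _ = _ := integral_complex_ofReal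

end Signs

/-! ### Finite-dimensional limits of the sign-randomized process -/

section SignProcess

variable {Θ Ω : Type*} [MeasurableSpace Ω] {P : Measure Ω}

lemma empiricalCov_comm (d : ℕ → Θ → ℝ) (n : ℕ) (θ₁ θ₂ : Θ) :
    empiricalCov d n θ₁ θ₂ = empiricalCov d n θ₂ θ₁ := by
  simp only [empiricalCov, mul_comm]

/-- The quadratic form of the empirical covariance as a mean of squares. -/
lemma sum_sq_eq_sum_empiricalCov (d : ℕ → Θ → ℝ) (n : ℕ) (I : Finset Θ) (t : I → ℝ) :
    ∑ k ∈ Finset.range n, ((√(n : ℝ))⁻¹ * ∑ θ, t θ * d k θ) ^ 2 =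
      ∑ θ₁, ∑ θ₂, t θ₁ * t θ₂ * empiricalCov d n θ₁ θ₂ := by
  have hsq : ((√(n : ℝ))⁻¹) ^ 2 = (n : ℝ)⁻¹ := by rw [inv_pow, Real.sq_sqrt (Nat.cast_nonneg n)]
  simp_rw [mul_pow, hsq, ← Finset.mul_sum, sq, Finset.sum_mul_sum, empiricalCov, Finset.mul_sum]
  rw [Finset.sum_comm]
  refine Finset.sum_congr rfl fun θ₁ _ ↦ ?_
  rw [Finset.sum_comm]
  refine Finset.sum_congr rfl fun θ₂ _ ↦ Finset.sum_congr rfl fun k _ ↦ ?_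
  ring

lemma sum_mul_signProcess (d : ℕ → Θ → ℝ) (s : ℕ → ℝ) (n : ℕ) (I : Finset Θ) (t : I → ℝ) :
    ∑ θ, t θ * signProcess d s n θ =
      ∑ k ∈ Finset.range n, ((√(n : ℝ))⁻¹ * ∑ θ, t θ * d k θ) * s k := by
  simp_rw [signProcess, Finset.mul_sum, Finset.sum_mul]
  rw [Finset.sum_comm]
  refine Finset.sum_congr rfl fun k _ ↦ Finset.sum_congr rfl fun θ _ ↦ ?_
  ring

lemma measurable_signProcess {σ : ℕ → Ω → ℝ} (hσ : ∀ k, Measurable (σ k))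
    {d : Ω → ℕ → Θ → ℝ} (hd : Measurable d) (n : ℕ) (I : Finset Θ) :
    Measurable fun ω (θ : I) ↦ signProcess (d ω) (σ · ω) n θ := by
  refine measurable_pi_lambda _ fun θ ↦ ?_
  unfold signProcess
  refine (Finset.measurable_fun_sum _ fun k _ ↦ .mul ?_ (hσ k)).const_mul _
  exact (measurable_pi_apply _).comp ((measurable_pi_apply k).comp hd)

lemma tendstoInMeasure_sum_sq {d : Ω → ℕ → Θ → ℝ} {γ : Θ → Θ → ℝ}
    (hγ : ∀ θ₁ θ₂, TendstoInMeasure P (fun n ω ↦ empiricalCov (d ω) n θ₁ θ₂) atTop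
      (fun _ ↦ γ θ₁ θ₂)) (I : Finset Θ) (t : I → ℝ) :
    TendstoInMeasure P
      (fun n ω ↦ ∑ k ∈ Finset.range n, ((√(n : ℝ))⁻¹ * ∑ θ, t θ * d ω k θ) ^ 2) atTop
      (fun _ ↦ ∑ θ₁, ∑ θ₂, t θ₁ * t θ₂ * γ θ₁ θ₂) := by
  simp_rw [sum_sq_eq_sum_empiricalCov]
  exact TendstoInMeasure.finset_sum _ fun θ₁ _ ↦ TendstoInMeasure.finset_sum _ fun θ₂ _ ↦
    (hγ θ₁ θ₂).const_mul _

lemma dotProduct_mulVec_of (γ : Θ → Θ → ℝ) (I : Finset Θ) (t : I → ℝ) :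
    dotProduct t (Matrix.mulVec (Matrix.of fun θ₁ θ₂ : I ↦ γ θ₁ θ₂) t) =
      ∑ θ₁, ∑ θ₂, t θ₁ * t θ₂ * γ θ₁ θ₂ := by
  simp only [dotProduct, Matrix.mulVec, Matrix.of_apply, Finset.mul_sum]
  refine Finset.sum_congr rfl fun _ _ ↦ Finset.sum_congr rfl fun _ _ ↦ ?_
  ring

/-- The Lindeberg condition passes from single indices to linear combinations: by
`sqTail_sum_mul_le` the tail at `ε` is controlled by the individual tails at `ε / M`. -/
lemma tendsto_sum_lintegral_sqTail {d : Ω → ℕ → Θ → ℝ} (hd : ∀ k θ, Measurable fun ω ↦ d ω k θ)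
    (hL : LindebergCondition P (fun k θ ω ↦ d ω k θ)) (I : Finset Θ) (t : I → ℝ) {ε : ℝ}
    (hε : 0 < ε) :
    Tendsto (fun n : ℕ ↦ ∑ k ∈ Finset.range n,
      ∫⁻ ω, sqTail ((√(n : ℝ))⁻¹ * ∑ θ, t θ * d ω k θ) ε ∂P) atTop (𝓝 0) := by
  set M := 1 + ∑ θ, |t θ| with hM
  have hMpos : 0 < M := by positivity
  have hsingle (θ : Θ) : Tendsto (fun n : ℕ ↦ (n : ℝ≥0∞)⁻¹ *
      ∑ k ∈ Finset.range n, ∫⁻ ω, sqTail (d ω k θ) (ε / M * √(n : ℝ)) ∂P) atTop (𝓝 0) :=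
    tendsto_of_le_liminf_of_limsup_le zero_le (hL θ (ε / M) (div_pos hε hMpos)).le
  have hlim : Tendsto (fun n : ℕ ↦ ENNReal.ofReal (M ^ 2) * ∑ θ : I, (n : ℝ≥0∞)⁻¹ *
      ∑ k ∈ Finset.range n, ∫⁻ ω, sqTail (d ω k θ) (ε / M * √(n : ℝ)) ∂P) atTop (𝓝 0) := by
    have := ENNReal.Tendsto.const_mul (a := ENNReal.ofReal (M ^ 2))
      (tendsto_finsetSum (Finset.univ : Finset I) fun θ _ ↦ hsingle θ) (by simp)
    simpa using this
  refine tendsto_of_tendsto_of_tendsto_of_le_of_le' tendsto_const_nhds hlim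
    (.of_forall fun _ ↦ zero_le) ?_
  filter_upwards [eventually_gt_atTop 0] with n hn
  have hn' : (0 : ℝ) < n := Nat.cast_pos.2 hn
  have hs : 0 < (√(n : ℝ))⁻¹ := inv_pos.2 (Real.sqrt_pos.2 hn')
  have hsq : ENNReal.ofReal (((√(n : ℝ))⁻¹) ^ 2) = (n : ℝ≥0∞)⁻¹ := by
    rw [inv_pow, Real.sq_sqrt hn'.le, ENNReal.ofReal_inv_of_pos hn', ENNReal.ofReal_natCast]
  have hmeas k (θ : I) (c : ℝ) : Measurable fun ω ↦ sqTail (d ω k θ) c :=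
    (measurable_sqTail c).comp (hd k θ)
  calc ∑ k ∈ Finset.range n, ∫⁻ ω, sqTail ((√(n : ℝ))⁻¹ * ∑ θ, t θ * d ω k θ) ε ∂P
      ≤ ∑ k ∈ Finset.range n, ∫⁻ ω, (n : ℝ≥0∞)⁻¹ * (ENNReal.ofReal (M ^ 2) *
          ∑ θ : I, sqTail (d ω k θ) (ε / M * √(n : ℝ))) ∂P := by
        refine Finset.sum_le_sum fun k _ ↦ lintegral_mono fun ω ↦ ?_
        rw [sqTail_mul hs, hsq]
        gcongr
        refine (sqTail_sum_mul_le Finset.univ t (fun θ : I ↦ d ω k θ) _).trans ?_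
        rw [div_inv_eq_mul, ← hM, mul_div_right_comm]
    _ = ∑ k ∈ Finset.range n, (n : ℝ≥0∞)⁻¹ * (ENNReal.ofReal (M ^ 2) *
          ∑ θ : I, ∫⁻ ω, sqTail (d ω k θ) (ε / M * √(n : ℝ)) ∂P) := by
        refine Finset.sum_congr rfl fun k _ ↦ ?_
        rw [lintegral_const_mul _ (.const_mul (Finset.measurable_fun_sum _ fun θ _ ↦ hmeas k θ _) _),
          lintegral_const_mul _ (Finset.measurable_fun_sum _ fun θ _ ↦ hmeas k θ _),
          lintegral_finsetSum _ fun θ _ ↦ hmeas k θ _]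
    _ = _ := by
        simp_rw [← Finset.mul_sum]
        rw [Finset.sum_comm]
        ring

variable [IsProbabilityMeasure P]

/-- Limits of empirical covariances are positive semidefinite. -/
lemma posSemidef_of_tendstoInMeasure_empiricalCov {d : Ω → ℕ → Θ → ℝ} {γ : Θ → Θ → ℝ}
    (hγ : ∀ θ₁ θ₂, TendstoInMeasure P (fun n ω ↦ empiricalCov (d ω) n θ₁ θ₂) atTop
      (fun _ ↦ γ θ₁ θ₂)) (I : Finset Θ) :
    (Matrix.of fun θ₁ θ₂ : I ↦ γ θ₁ θ₂).PosSemidef := by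
  refine Matrix.PosSemidef.of_dotProduct_mulVec_nonneg ?_ fun t ↦ ?_
  -- Symmetry: `γ θ₁ θ₂` and `γ θ₂ θ₁` are limits in probability of the same sequence.
  · ext θ₁ θ₂
    have h := hγ θ₂ θ₁
    simp_rw [empiricalCov_comm _ _ (θ₂ : Θ) (θ₁ : Θ)] at h
    obtain ⟨_, hω⟩ := (tendstoInMeasure_ae_unique (hγ θ₁ θ₂) h).exists
    simpa using hω.symm
  · rw [star_trivial, dotProduct_mulVec_of]
    exact (tendstoInMeasure_sum_sq hγ I t).nonneg fun n ω ↦ Finset.sum_nonneg fun _ _ ↦ sq_nonneg _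

/-- The characteristic function of a linear combination of the coordinates of the sign-randomized
process. -/
lemma charFun_map_signProcess {σ : ℕ → Ω → ℝ} (hσ : IsRademacherSeq P σ)
    {d : Ω → ℕ → Θ → ℝ} (hd : Measurable d) (hind : IndepFun d (fun ω k ↦ σ k ω) P)
    (n : ℕ) (I : Finset Θ) (t : EuclideanSpace ℝ I) :
    charFun (P.map fun ω ↦
      (WithLp.toLp 2 fun θ : I ↦ signProcess (d ω) (σ · ω) n θ : EuclideanSpace ℝ I)) t =
      (∫ ω, ∏ k ∈ Finset.range n, Real.cos ((√(n : ℝ))⁻¹ * ∑ θ : I, t θ * d ω k θ) ∂P : ℝ) := by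
  have hφ : Measurable fun (x : ℕ → Θ → ℝ) (k : ℕ) ↦ (√(n : ℝ))⁻¹ * ∑ θ : I, t θ * x k θ := by
    fun_prop
  have hDm := (measurable_signProcess hσ.measurable hd n I)
  have hlp : Measurable fun ω ↦
      (WithLp.toLp 2 fun θ : I ↦ signProcess (d ω) (σ · ω) n θ : EuclideanSpace ℝ I) :=
    (WithLp.measurable_toLp 2 (I → ℝ)).comp hDm
  rw [charFun_apply, integral_map hlp.aemeasurable
    (Measurable.aestronglyMeasurable (by fun_prop))]
  refine Eq.trans ?_
    (hσ.integral_exp_sum_of_indepFun n (hφ.comp hd) (hind.comp hφ measurable_id))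
  congr with ω
  beta_reduce
  rw [← sum_mul_signProcess, PiLp.inner_apply]
  simp [mul_comm]

lemma map_toLp_gaussianFamily [DecidableEq Θ] (γ : Θ → Θ → ℝ) (I : Finset Θ) :
    (gaussianFamily γ I).map (WithLp.toLp 2 : (I → ℝ) → EuclideanSpace ℝ I) =
      multivariateGaussian 0 (Matrix.of fun θ₁ θ₂ : I ↦ γ θ₁ θ₂) := by
  rw [gaussianFamily, Measure.map_map (WithLp.measurable_toLp 2 _) (MeasurableEquiv.measurable _)]
  have hid : (WithLp.toLp 2 : (I → ℝ) → EuclideanSpace ℝ I) ∘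
      (MeasurableEquiv.toLp 2 (I → ℝ)).symm = id := rfl
  rw [hid, Measure.map_id]
  congr!

/-- The finite-dimensional distributions of the sign-randomized process of random data `d`,
independent of the signs, converge to those of a centered Gaussian process. -/
theorem fidiTendstoCenteredGaussian_signProcess {σ : ℕ → Ω → ℝ} (hσ : IsRademacherSeq P σ)
    {d : Ω → ℕ → Θ → ℝ} (hd : Measurable d) (hind : IndepFun d (fun ω k ↦ σ k ω) P)
    {γ : Θ → Θ → ℝ}
    (hγ : ∀ θ₁ θ₂, TendstoInMeasure P (fun n ω ↦ empiricalCov (d ω) n θ₁ θ₂) atTop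
      (fun _ ↦ γ θ₁ θ₂))
    (hL : LindebergCondition P (fun k θ ω ↦ d ω k θ)) :
    FidiTendstoCenteredGaussian P (fun n θ ω ↦ signProcess (d ω) (σ · ω) n θ) γ := by
  classical
  have hdm k θ : Measurable fun ω ↦ d ω k θ :=
    (measurable_pi_apply θ).comp ((measurable_pi_apply k).comp hd)
  have hpsd := posSemidef_of_tendstoInMeasure_empiricalCov hγ
  obtain ⟨Ω', mΩ', P', hP', Z, hZ, hmean, hcov, hlaw⟩ := exists_isGaussianProcess hpsd
  refine ⟨Ω', mΩ', P', hP', Z, hZ, hmean, hcov, fun I ↦ ?_⟩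
  have hDm n := measurable_signProcess hσ.measurable hd n I
  have hlp := WithLp.measurable_toLp 2 (I → ℝ)
  have hZm := (hlaw I).aemeasurable
  have hlimit : P'.map (fun ω ↦ (WithLp.toLp 2 fun θ : I ↦ Z θ ω : EuclideanSpace ℝ I)) =
      multivariateGaussian 0 (Matrix.of fun θ₁ θ₂ : I ↦ γ θ₁ θ₂) := by
    rw [← map_toLp_gaussianFamily, ← (hlaw I).map_eq]
    exact (AEMeasurable.map_map_of_aemeasurable hlp.aemeasurable hZm).symm
  -- Characteristic functions need an inner product, so Lévy's theorem is applied in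
  -- `EuclideanSpace` and the result is carried back to `I → ℝ` by a continuous map.
  have h : TendstoInDistribution
      (fun n ω ↦ (WithLp.toLp 2 fun θ : I ↦ signProcess (d ω) (σ · ω) n θ : EuclideanSpace ℝ I))
      atTop (fun ω ↦ (WithLp.toLp 2 fun θ : I ↦ Z θ ω : EuclideanSpace ℝ I)) (fun _ ↦ P) P' := by
    refine ⟨fun n ↦ (hlp.comp (hDm n)).aemeasurable, hlp.comp_aemeasurable hZm, ?_⟩
    refine ProbabilityMeasure.tendsto_of_tendsto_charFun fun t ↦ ?_
    simp only [ProbabilityMeasure.coe_mk, hlimit, charFun_map_signProcess hσ hd hind]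
    rw [charFun_multivariateGaussian (hpsd I), dotProduct_mulVec_of, inner_zero_right]
    have hmain := tendsto_integral_prod_cos (P := P)
      (x := fun n k ω ↦ (√(n : ℝ))⁻¹ * ∑ θ : I, t θ * d ω k θ)
      (fun n k ↦ (Finset.measurable_fun_sum _ fun (θ : I) _ ↦
        (hdm k θ).const_mul (t θ)).const_mul _)
      (tendstoInMeasure_sum_sq hγ I t)
      fun ε hε ↦ tendsto_sum_lintegral_sqTail hdm hL I t hε
    have := (Complex.continuous_ofReal.tendsto _).comp hmain
    rw [Function.comp_def, Complex.ofReal_exp, Complex.ofReal_neg, Complex.ofReal_div] at this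
    simpa only [Complex.ofReal_zero, zero_mul, zero_sub, Complex.ofReal_ofNat] using this
  exact h.continuous_comp (g := (WithLp.ofLp : EuclideanSpace ℝ I → I → ℝ))
    (PiLp.continuous_ofLp 2 _)

end SignProcess

/-! ### The theorem for random and for fixed data -/

theorem proposition3 {Θ X Y Ω : Type*} [MeasurableSpace X] [MeasurableSpace Y]
    [MeasurableSpace Ω] (P : Measure Ω) [IsProbabilityMeasure P]
    -- an arbitrary family of scoring functions
    (S : Θ → X → Y → ℝ) (hS : ∀ θ, Measurable (fun p : X × Y ↦ S θ p.1 p.2))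
    -- the random signs
    (σ : ℕ → Ω → ℝ) (hσ : IsRademacherSeq P σ) :
    -- a) random data, from which the signs are independent
    (∀ (x₁ x₂ : ℕ → Ω → X) (y : ℕ → Ω → Y),
      (∀ k, Measurable (x₁ k)) → (∀ k, Measurable (x₂ k)) → (∀ k, Measurable (y k)) →
      IndepFun (fun ω k ↦ (x₁ k ω, x₂ k ω, y k ω)) (fun ω k ↦ σ k ω) P →
      ∀ γ : Θ → Θ → ℝ, (∀ θ, 0 < γ θ θ) →
        (∀ θ₁ θ₂, TendstoInMeasure P
          (fun (n : ℕ) ω ↦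
            empiricalCov (scoreDiff S (x₁ · ω) (x₂ · ω) (y · ω)) n θ₁ θ₂)
          atTop (fun _ ↦ γ θ₁ θ₂)) →
        LindebergCondition P (fun k θ ω ↦ scoreDiff S (x₁ · ω) (x₂ · ω) (y · ω) k θ) →
        FidiTendstoCenteredGaussian P
          (fun n θ ω ↦
            signProcess (scoreDiff S (x₁ · ω) (x₂ · ω) (y · ω)) (σ · ω) n θ) γ) ∧
    -- b) given (fixed, non-random) data, the signs being the sole source of randomness
    (∀ (x₁ x₂ : ℕ → X) (y : ℕ → Y) (γ : Θ → Θ → ℝ), (∀ θ, 0 < γ θ θ) →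
      (∀ θ₁ θ₂, Tendsto (fun n : ℕ ↦ empiricalCov (scoreDiff S x₁ x₂ y) n θ₁ θ₂)
        atTop (𝓝 (γ θ₁ θ₂))) →
      DataLindebergCondition (scoreDiff S x₁ x₂ y) →
      FidiTendstoCenteredGaussian P
        (fun n θ ω ↦ signProcess (scoreDiff S x₁ x₂ y) (σ · ω) n θ) γ) := by
  constructor
  · intro x₁ x₂ y hx₁ hx₂ hy hind γ _ hγ hL
    -- The score differences are a measurable function of the data, so they inherit independence
    -- from the signs. In the product σ-algebra measurability is checked coordinatewise, hence `Θ`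
    -- may be arbitrary.
    have hφ : Measurable fun (z : ℕ → X × X × Y) (k : ℕ) (θ : Θ) ↦
        S θ (z k).1 (z k).2.2 - S θ (z k).2.1 (z k).2.2 := by
      refine measurable_pi_lambda _ fun k ↦ measurable_pi_lambda _ fun θ ↦ ?_
      have hz : Measurable fun z : ℕ → X × X × Y ↦ z k := measurable_pi_apply k
      exact ((hS θ).comp (hz.fst.prodMk hz.snd.snd)).sub
        ((hS θ).comp (hz.snd.fst.prodMk hz.snd.snd))
    have hdata : Measurable fun ω k ↦ (x₁ k ω, x₂ k ω, y k ω) :=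
      measurable_pi_lambda _ fun k ↦ (hx₁ k).prodMk ((hx₂ k).prodMk (hy k))
    exact fidiTendstoCenteredGaussian_signProcess hσ
      (d := fun ω ↦ scoreDiff S (x₁ · ω) (x₂ · ω) (y · ω)) (hφ.comp hdata)
      (hind.comp hφ measurable_id) hγ hL
  · intro x₁ x₂ y γ _ hγ hL
    -- Constant data are independent of the signs, and their expectations under the probability
    -- measure `P` are the values themselves.
    refine fidiTendstoCenteredGaussian_signProcess hσ (d := fun _ ↦ scoreDiff S x₁ x₂ y)
      measurable_const (indepFun_const_left _ _) (fun θ₁ θ₂ ↦ ?_) ?_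
    · exact tendstoInMeasure_of_tendsto_ae (fun _ ↦ aestronglyMeasurable_const)
        (ae_of_all _ fun _ ↦ hγ θ₁ θ₂)
    · intro θ ε hε
      simpa using hL θ ε hε
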